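/- Let $X$ be a finite totally ordered set and let $P$ be the set of all non-associative words on $X$, including the empty word $1$. Write $|v|$ for the number of letters of $v$, and $v_1v_2\cdots v_n$ without brackets for the left-normed product $(\cdots((v_1v_2)v_3)\cdots)v_n$. The subwords of a letter $x$ are $\{x\}$, and $\mathrm{Sub}(uv)=\{uv\}\cup \mathrm{Sub}(u)\cup \mathrm{Sub}(v)$ for nonempty $u,v$. Let $W\subset P$ consist of $1$ and of all nonempty words that have no subword of the form $uu$ or $(uv)v$ with $u,v$ nonempty. Define $\pi\colon P\to W$ by $\pi(1)=1$; $\pi(x)=x$ for $x\in X$; for $u,v\in W$, $\pi(uv)=1$ if $u=v$, $\pi(uv)=a$ if $u=av$, and $\pi(uv)=uv$ if $uv\in W$; and $\pi(uv)=\pi(\pi(u)\pi(v))$ if $u\notin W$ or $v\notin W$. Order nonempty words by length; words of length one as in $X$; words $u=u_1u_2$, $v=v_1v_2$ of equal length $\geq 2$ first by $u_2,v_2$ and then, if $u_2=v_2$, by $u_1,v_1$. Every nonempty word is uniquely $y=y_1y_2\cdots y_m$ with $|y_1|=1$; put $y^t=y_m y_{m-1}\cdots y_1$ (left-normed) and $y^{tt}=(y^t)^t$.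 Let $y_0=\min\{y^t,y^{tt}\}$ and $D=\{y_0 : y,y_0,y_0^t\in W,\ y_0^t\neq y_0\}$, with $y$ nonempty. Put $R_1=X$, $R_n=R_{n-1}\cup\{y\in D : |y|\le n,\ y=u_1u_2\cdots u_m \text{ with all } u_i\in R_{n-1}\}$ for $n>1$, and $R(X)=\bigcup_{n\ge 1}R_n$. Let $B(X)=\{1\}\cup\{y\in W : y=y_1y_2\cdots y_n,\ n\ge 1,\ y_i\in R(X)\}$. For every $g\in B(X)\setminus\{1\}$ there are unique $g_1,\dots,g_m\in R(X)$, $m\ge1$, with $g_i\neq g_{i+1}$ for all $i<m$ and $g=\pi(g_1g_2\cdots g_{m-1}g_mg_{m-1}\cdots g_2g_1)$. Define $\circ$ on $B(X)$ by $x\circ1=1\circ x=x$ and, for $y\ne1$ with $y=\pi(y_1\cdots y_m\cdots y_1)$ in this way, $x\circ y=\pi(x\,y_1y_2\cdots y_{m-1}y_my_{m-1}\cdots y_1)$. (With this multiplication, $B(X)$ is the free Bol loop of exponent two on $X$.) Let $G$ be the free product of the groups $\langle R_y \mid R_y^2=1\rangle$ of order two, one for each $y\in R(X)$. It acts on $B(X)$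 from the right by $b\,R_y=b\circ y$. Let $H=\{g\in G : 1^g=1\}$ be the stabilizer of the empty word $1\in B(X)$. **Proposition 5.1.** $H$ is a core-free subgroup of $G$: if $N\le H$ is a subgroup that is normal in $G$, then $N=\{1\}$. -/

import Mathlib

namespace FreeBol

noncomputable section

universe u

/-! Words, reduced words and the reduction map. -/

/-- All non-associative words on `X`, with the empty word as `1`.  The elements of
`FreeMagma X` are the nonempty words. -/
abbrev P (X : Type u) : Type u := WithOne (FreeMagma X)

/-- The subwords of a nonempty word. -/
def subwords {X : Type u} : FreeMagma X → Set (FreeMagma X)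
  | FreeMagma.of x => {FreeMagma.of x}
  | FreeMagma.mul a b => {a * b} ∪ (subwords a ∪ subwords b)

/-- The words `aa` and `(ab)b`, with `a`, `b` nonempty. -/
def C (X : Type u) : Set (FreeMagma X) :=
  {w | ∃ a, w = a * a} ∪ {w | ∃ a b, w = (a * b) * b}

/-- The reduced words: the empty word, and the nonempty words without a subword in `C X`. -/
def W (X : Type u) : Set (P X) :=
  {1} ∪ {v | ∃ w : FreeMagma X, v = (w : P X) ∧ subwords w ∩ C X = ∅}

open Classical in
/-- The value of the reduction map on the product of two reduced words. -/
def redMul {X : Type u} (a b : P X) : P X :=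
  if a = b then 1 else if h : ∃ c, a = c * b then h.choose else a * b

/-- The reduction map on nonempty words: `π(x) = x` for a letter, and `π(ab)` is obtained by
applying the product rule to the reduced words `π(a)`, `π(b)`. -/
def piAux {X : Type u} : FreeMagma X → P X
  | FreeMagma.of x => (FreeMagma.of x : FreeMagma X)
  | FreeMagma.mul a b => redMul (piAux a) (piAux b)

/-- The reduction map `π`, with `π(1) = 1`. -/
def pi {X : Type u} (v : P X) : P X := WithOne.recOneCoe (motive := fun _ => P X) 1 piAux v

/-- `leftProd v [v₁, …, vₙ]` is the left-normed word `(…((v v₁) v₂) …) vₙ`. -/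
def leftProd {X : Type u} (v : P X) (l : List (FreeMagma X)) : P X :=
  l.foldl (fun a b => a * (b : P X)) v

/-! The order of words, transposition, and the sets `D`, `R` and `B`. -/

/-- The order of nonempty words: by length, then by the right factor, then by the left factor;
letters are compared in `X`. -/
def wordLT {X : Type u} [LinearOrder X] : FreeMagma X → FreeMagma X → Prop
  | FreeMagma.of x, FreeMagma.of y => x < y
  | FreeMagma.of _, FreeMagma.mul _ _ => True
  | FreeMagma.mul _ _, FreeMagma.of _ => False
  | FreeMagma.mul a b, FreeMagma.mul c d =>
      (a * b).length < (c * d).length ∨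
        ((a * b).length = (c * d).length ∧ (wordLT b d ∨ (b = d ∧ wordLT a c)))

open Classical in
/-- The smaller one of two words. -/
def wordMin {X : Type u} [LinearOrder X] (a b : FreeMagma X) : FreeMagma X :=
  if wordLT b a then b else a

/-- The list `[y₁, …, yₘ]` of the factors in the decomposition `y = (…(y₁ y₂) …) yₘ` with `y₁` a
letter. -/
def factors {X : Type u} : FreeMagma X → List (FreeMagma X)
  | FreeMagma.of x => [FreeMagma.of x]
  | FreeMagma.mul a b => factors a ++ [b]

/-- The word `yᵗ = (…(yₘ yₘ₋₁) …) y₁`, where `[y₁, …, yₘ]` are the factors of `y`. -/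
def tr {X : Type u} : FreeMagma X → FreeMagma X
  | FreeMagma.of x => FreeMagma.of x
  | FreeMagma.mul a b => (factors a).reverse.foldl (fun p q => p * q) b

/-- The word `y₀ = min {yᵗ, yᵗᵗ}`. -/
def rep {X : Type u} [LinearOrder X] (y : FreeMagma X) : FreeMagma X :=
  wordMin (tr y) (tr (tr y))

/-- The set of all `y₀` such that `y`, `y₀`, `y₀ᵗ` are reduced and `y₀ᵗ ≠ y₀`. -/
def D (X : Type u) [LinearOrder X] : Set (FreeMagma X) :=
  {z | ∃ y : FreeMagma X, z = rep y ∧ (y : P X) ∈ W X ∧ (rep y : P X) ∈ W X ∧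
    (tr (rep y) : P X) ∈ W X ∧ tr (rep y) ≠ rep y}

/-- The sets `R₁ ⊆ R₂ ⊆ …` (with `R₀` empty). -/
def Rn (X : Type u) [LinearOrder X] : ℕ → Set (FreeMagma X)
  | 0 => ∅
  | 1 => Set.range FreeMagma.of
  | n + 2 => Rn X (n + 1) ∪ {y | y ∈ D X ∧ y.length ≤ n + 2 ∧
      ∃ l : List (FreeMagma X), (∀ a ∈ l, a ∈ Rn X (n + 1)) ∧ (y : P X) = leftProd 1 l}

/-- The set `R(X)`, the union of the `Rₙ`. -/
def R (X : Type u) [LinearOrder X] : Set (FreeMagma X) := ⋃ n, Rn X n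

/-- The set `B(X)`: the empty word and the reduced left-normed products of elements of `R(X)`. -/
def B (X : Type u) [LinearOrder X] : Set (P X) :=
  {1} ∪ {y | y ∈ W X ∧
    ∃ l : List (FreeMagma X), l ≠ [] ∧ (∀ a ∈ l, a ∈ R X) ∧ y = leftProd 1 l}

/-! The multiplication of `B(X)`. -/

/-- The palindrome `[g₁, …, gₘ₋₁, gₘ, gₘ₋₁, …, g₁]`. -/
def palin {A : Type u} (l : List A) : List A := l ++ l.reverse.tail

/-- `[g₁, …, gₘ]`, `m ≥ 1`, is a list of elements of `R(X)`, any two consecutive ones distinct,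
with `g = π(g₁ … gₘ₋₁ gₘ gₘ₋₁ … g₁)`. -/
def IsSymRep {X : Type u} [LinearOrder X] (g : P X) (l : List (FreeMagma X)) : Prop :=
  l ≠ [] ∧ (∀ a ∈ l, a ∈ R X) ∧ l.IsChain (· ≠ ·) ∧ g = pi (leftProd 1 (palin l))

open Classical in
/-- A list `[g₁, …, gₘ]` as in `IsSymRep` (there is exactly one for each `g ∈ B(X) \ {1}`). -/
def symList {X : Type u} [LinearOrder X] (g : P X) : List (FreeMagma X) :=
  if h : ∃ l, IsSymRep g l then h.choose else []

open Classical in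
/-- The multiplication `∘` of `B(X)`: `x ∘ 1 = x`, `1 ∘ y = y`, and otherwise
`x ∘ y = π(x y₁ … yₘ₋₁ yₘ yₘ₋₁ … y₁)`, where `[y₁, …, yₘ] = symList y`. -/
def circ {X : Type u} [LinearOrder X] (x y : P X) : P X :=
  if y = 1 then x else if x = 1 then y else pi (leftProd x (palin (symList y)))

/-! Right multiplication by an element of `R(X)` is an involution of `B(X)`. -/

theorem coe_ne_coe_mul {X : Type u} (a b : FreeMagma X) : b ≠ a * b := fun h => by
  have h1 := congrArg FreeMagma.length h
  have h2 : (a * b).length = a.length + b.length := rfl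
  have h3 := a.length_pos
  omega

theorem mul_inj' {X : Type u} {a b c d : FreeMagma X} (h : a * b = c * d) : a = c ∧ b = d := by
  change FreeMagma.mul a b = FreeMagma.mul c d at h
  injection h with h1 h2
  exact ⟨h1, h2⟩

theorem mul_coe_right_inj {X : Type u} {a c : P X} {b : FreeMagma X}
    (h : a * (b : P X) = c * (b : P X)) : a = c := by
  induction a using WithOne.recOneCoe with
  | one =>
    induction c using WithOne.recOneCoe with
    | one => rfl
    | coe c =>
      rw [one_mul, ← WithOne.coe_mul, WithOne.coe_inj] at h
      exact absurd h (coe_ne_coe_mul c b)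
  | coe a =>
    induction c using WithOne.recOneCoe with
    | one =>
      rw [one_mul, ← WithOne.coe_mul, WithOne.coe_inj] at h
      exact absurd h.symm (coe_ne_coe_mul a b)
    | coe c =>
      rw [← WithOne.coe_mul, ← WithOne.coe_mul, WithOne.coe_inj] at h
      rw [(mul_inj' h).1]

theorem redMul_one {X : Type u} (a : P X) : redMul a 1 = a := by
  unfold redMul
  split_ifs with h h'
  · exact h.symm
  · have := h'.choose_spec
    rw [mul_one] at this
    exact this.symm
  · exact absurd ⟨a, (mul_one a).symm⟩ h'

theorem redMul_self {X : Type u} (a : P X) : redMul a a = 1 := by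
  simp [redMul]

theorem redMul_mul {X : Type u} (a : P X) (b : FreeMagma X) :
    redMul (a * (b : P X)) (b : P X) = a := by
  unfold redMul
  have h' : ∃ c, a * (b : P X) = c * (b : P X) := ⟨a, rfl⟩
  split_ifs with h
  · refine mul_coe_right_inj (b := b) ?_
    rw [one_mul, h]
  · exact (mul_coe_right_inj h'.choose_spec).symm

theorem redMul_of_not {X : Type u} {a b : P X} (h : ¬ ∃ c, a = c * b) : redMul a b = a * b := by
  have h1 : a ≠ b := fun e => h ⟨1, by rw [one_mul, e]⟩
  simp only [redMul, if_neg h1, dif_neg h]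

theorem one_redMul {X : Type u} (b : P X) : redMul 1 b = b := by
  induction b using WithOne.recOneCoe with
  | one => exact redMul_one 1
  | coe b =>
    rw [redMul_of_not, one_mul]
    rintro ⟨c, hc⟩
    induction c using WithOne.recOneCoe with
    | one => simp at hc
    | coe c => rw [← WithOne.coe_mul] at hc; exact WithOne.one_ne_coe hc

theorem one_mem_W (X : Type u) : (1 : P X) ∈ W X := Or.inl rfl

theorem coe_mem_W {X : Type u} (w : FreeMagma X) :
    (w : P X) ∈ W X ↔ subwords w ∩ C X = ∅ := by
  constructor
  · rintro (h | ⟨v, hv, h⟩)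
    · exact absurd h WithOne.coe_ne_one
    · rw [WithOne.coe_inj] at hv
      rwa [hv]
  · exact fun h => Or.inr ⟨w, rfl, h⟩

theorem of_mem_W {X : Type u} (x : X) : ((FreeMagma.of x : FreeMagma X) : P X) ∈ W X := by
  rw [coe_mem_W, Set.eq_empty_iff_forall_notMem]
  rintro w ⟨h1, h2⟩
  have h1' : w = FreeMagma.of x := h1
  subst h1'
  rcases h2 with ⟨a, h⟩ | ⟨a, b, h⟩ <;> cases h

theorem mul_mem_W {X : Type u} (a b : FreeMagma X) :
    ((a * b : FreeMagma X) : P X) ∈ W X ↔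
      (a : P X) ∈ W X ∧ (b : P X) ∈ W X ∧ a ≠ b ∧ ∀ c, a ≠ c * b := by
  have hs : subwords (a * b) = {a * b} ∪ (subwords a ∪ subwords b) := rfl
  simp only [coe_mem_W, hs, Set.eq_empty_iff_forall_notMem]
  constructor
  · intro h
    refine ⟨fun w hw => h w ⟨Or.inr (Or.inl hw.1), hw.2⟩,
      fun w hw => h w ⟨Or.inr (Or.inr hw.1), hw.2⟩, fun e => ?_, fun c e => ?_⟩
    · exact h (a * b) ⟨Or.inl rfl, Or.inl ⟨a, by rw [e]⟩⟩
    · exact h (a * b) ⟨Or.inl rfl, Or.inr ⟨c, b, by rw [e]⟩⟩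
  · rintro ⟨ha, hb, h1, h2⟩ w ⟨hw | hw | hw, hc⟩
    · have hw' : w = a * b := hw
      subst hw'
      rcases hc with ⟨d, hd⟩ | ⟨d, e, hd⟩
      · exact h1 ((mul_inj' hd).1.trans (mul_inj' hd).2.symm)
      · obtain ⟨h3, h4⟩ := mul_inj' hd
        exact h2 d (by rw [h3, h4])
    · exact ha w ⟨hw, hc⟩
    · exact hb w ⟨hw, hc⟩

/-- The three cases of the product rule. -/
theorem redMul_cases {X : Type u} {a : P X} (b : FreeMagma X) (ha : a ∈ W X)
    (hb : (b : P X) ∈ W X) :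
    (∃ c ∈ W X, a = c * (b : P X) ∧ redMul a b = c) ∨
      (a * (b : P X) ∈ W X ∧ redMul a b = a * (b : P X)) := by
  by_cases h : ∃ c, a = c * (b : P X)
  · left
    obtain ⟨c, rfl⟩ := h
    refine ⟨c, ?_, rfl, redMul_mul c b⟩
    induction c using WithOne.recOneCoe with
    | one => exact one_mem_W X
    | coe c =>
      rw [← WithOne.coe_mul, mul_mem_W] at ha
      exact ha.1
  · right
    refine ⟨?_, redMul_of_not h⟩
    induction a using WithOne.recOneCoe with
    | one => rwa [one_mul]
    | coe a =>
      rw [← WithOne.coe_mul, mul_mem_W]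
      refine ⟨ha, hb, fun e => h ⟨1, by rw [one_mul, e]⟩, fun c e => h ⟨c, ?_⟩⟩
      rw [e, WithOne.coe_mul]

theorem redMul_mem_W {X : Type u} {a b : P X} (ha : a ∈ W X) (hb : b ∈ W X) :
    redMul a b ∈ W X := by
  induction b using WithOne.recOneCoe with
  | one => rwa [redMul_one]
  | coe b =>
    rcases redMul_cases b ha hb with ⟨c, hc, -, h⟩ | ⟨hc, h⟩
    · rwa [h]
    · rwa [h]

theorem redMul_redMul {X : Type u} {a : P X} {b : FreeMagma X} (ha : a ∈ W X)
    (hb : (b : P X) ∈ W X) : redMul (redMul a b) b = a := by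
  rcases redMul_cases b ha hb with ⟨c, hc, h1, h⟩ | ⟨hc, h⟩
  · rw [h]
    rcases redMul_cases b hc hb with ⟨d, hd, h2, h3⟩ | ⟨-, h3⟩
    · exfalso
      subst h2
      subst h1
      induction d using WithOne.recOneCoe with
      | one =>
        rw [one_mul, ← WithOne.coe_mul, mul_mem_W] at ha
        exact ha.2.2.1 rfl
      | coe d =>
        rw [← WithOne.coe_mul, ← WithOne.coe_mul, mul_mem_W] at ha
        exact ha.2.2.2 d rfl
    · rw [h3, h1]
  · rw [h, redMul_mul]

theorem pi_one {X : Type u} : pi (1 : P X) = 1 := rfl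

theorem pi_mul {X : Type u} (a b : P X) : pi (a * b) = redMul (pi a) (pi b) := by
  induction a using WithOne.recOneCoe with
  | one => rw [one_mul, pi_one, one_redMul]
  | coe a =>
    induction b using WithOne.recOneCoe with
    | one => rw [mul_one, pi_one, redMul_one]
    | coe b => rfl

theorem pi_of_mem_W {X : Type u} {a : P X} (ha : a ∈ W X) : pi a = a := by
  induction a using WithOne.recOneCoe with
  | one => rfl
  | coe a =>
    induction a with
    | ih1 x => rfl
    | ih2 a b iha ihb =>
      have ha' := (mul_mem_W a b).1 ha
      change pi ((a * b : FreeMagma X) : P X) = ((a * b : FreeMagma X) : P X)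
      rw [WithOne.coe_mul, pi_mul, iha ha'.1, ihb ha'.2.1]
      apply redMul_of_not
      rintro ⟨c, hc⟩
      induction c using WithOne.recOneCoe with
      | one => rw [one_mul, WithOne.coe_inj] at hc; exact ha'.2.2.1 hc
      | coe c => rw [← WithOne.coe_mul, WithOne.coe_inj] at hc; exact ha'.2.2.2 c hc

theorem Rn_subset_W {X : Type u} [LinearOrder X] (n : ℕ) :
    ∀ y ∈ Rn X n, (y : P X) ∈ W X := by
  induction n with
  | zero => intro y hy; exact absurd hy (Set.notMem_empty y)
  | succ n ih =>
    cases n with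
    | zero => rintro y ⟨x, rfl⟩; exact of_mem_W x
    | succ n =>
      rintro y (hy | ⟨⟨z, rfl, -, h, -⟩, -⟩)
      · exact ih y hy
      · exact h

theorem R_subset_W {X : Type u} [LinearOrder X] {y : FreeMagma X} (hy : y ∈ R X) :
    (y : P X) ∈ W X := by
  obtain ⟨n, hn⟩ := Set.mem_iUnion.1 hy
  exact Rn_subset_W n y hn

/-- The iterated product rule. -/
def redFold {X : Type u} (v : P X) (l : List (FreeMagma X)) : P X :=
  l.foldl (fun a b => redMul a (b : P X)) v

theorem pi_leftProd {X : Type u} (l : List (FreeMagma X)) :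
    ∀ v ∈ W X, (∀ a ∈ l, (a : P X) ∈ W X) → pi (leftProd v l) = redFold v l := by
  induction l using List.reverseRecOn with
  | nil => intro v hv _; exact pi_of_mem_W hv
  | append_singleton l b ih =>
    intro v hv hl
    have h1 : leftProd v (l ++ [b]) = leftProd v l * (b : P X) := by simp [leftProd]
    have h2 : redFold v (l ++ [b]) = redMul (redFold v l) b := by simp [redFold]
    rw [h1, h2, pi_mul, ih v hv (fun a ha => hl a (by simp [ha])), pi_of_mem_W (hl b (by simp))]

theorem leftProd_concat {X : Type u} (v : P X) (l : List (FreeMagma X)) (b : FreeMagma X) :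
    leftProd v (l ++ [b]) = leftProd v l * (b : P X) := by simp [leftProd]

theorem leftProd_ne_one {X : Type u} (v : P X) (l : List (FreeMagma X)) (b : FreeMagma X) :
    leftProd v (l ++ [b]) ≠ 1 := by
  rw [leftProd_concat]
  induction leftProd v l using WithOne.recOneCoe with
  | one => rw [one_mul]; exact WithOne.coe_ne_one
  | coe a => rw [← WithOne.coe_mul]; exact WithOne.coe_ne_one

/-- A nonempty left factor of an element of `R(X)` or of `B(X)` is a product of elements of
`R(X)`. -/
theorem left_of_leftProd {X : Type u} [LinearOrder X] {S : Set (FreeMagma X)} (hS : S ⊆ R X)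
    (h : ∀ w ∈ S, ∀ a b, w = a * b →
      ∃ l : List (FreeMagma X), l ≠ [] ∧ (∀ a ∈ l, a ∈ R X) ∧ (a : P X) = leftProd 1 l)
    (l : List (FreeMagma X)) (hl : ∀ a ∈ l, a ∈ S) (a b : FreeMagma X)
    (hab : ((a * b : FreeMagma X) : P X) = leftProd 1 l) :
    ∃ l : List (FreeMagma X), l ≠ [] ∧ (∀ a ∈ l, a ∈ R X) ∧ (a : P X) = leftProd 1 l := by
  induction l using List.reverseRecOn with
  | nil => exact absurd hab WithOne.coe_ne_one
  | append_singleton l c _ =>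
    by_cases hn : l = []
    · subst hn
      refine h c (hl c (by simp)) a b ?_
      have h1 : leftProd (1 : P X) ([] ++ [c]) = (c : P X) := by simp [leftProd]
      rw [h1, WithOne.coe_inj] at hab
      exact hab.symm
    · refine ⟨l, hn, fun d hd => hS (hl d (by simp [hd])), ?_⟩
      rw [leftProd_concat] at hab
      have h2 : leftProd (1 : P X) l ≠ 1 := by
        obtain ⟨l', d, rfl⟩ := List.eq_nil_or_concat l |>.resolve_left hn
        rw [List.concat_eq_append]
        exact leftProd_ne_one 1 l' d
      obtain ⟨e, he⟩ := WithOne.ne_one_iff_exists.1 h2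
      rw [← he, ← WithOne.coe_mul, WithOne.coe_inj] at hab
      rw [(mul_inj' hab).1, he]

theorem Rn_subset_R {X : Type u} [LinearOrder X] (n : ℕ) : Rn X n ⊆ R X :=
  Set.subset_iUnion (Rn X) n

theorem left_of_mem_Rn {X : Type u} [LinearOrder X] (n : ℕ) :
    ∀ w ∈ Rn X n, ∀ a b, w = a * b →
      ∃ l : List (FreeMagma X), l ≠ [] ∧ (∀ a ∈ l, a ∈ R X) ∧ (a : P X) = leftProd 1 l := by
  induction n with
  | zero => intro w hw; exact absurd hw (Set.notMem_empty w)
  | succ n ih =>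
    cases n with
    | zero => rintro w ⟨x, rfl⟩ a b h; cases h
    | succ n =>
      rintro w (hw | ⟨-, -, l, hl, hw⟩) a b h
      · exact ih w hw a b h
      · rw [h] at hw
        exact left_of_leftProd (Rn_subset_R (n + 1)) ih l hl a b hw

theorem left_mem_B {X : Type u} [LinearOrder X] {a : P X} {b : FreeMagma X}
    (h : a * (b : P X) ∈ B X) : a ∈ B X := by
  induction a using WithOne.recOneCoe with
  | one => exact Or.inl rfl
  | coe a =>
    rw [← WithOne.coe_mul] at h
    rcases h with h | ⟨hW, l, -, hl, h⟩
    · exact absurd h WithOne.coe_ne_one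
    · refine Or.inr ⟨((mul_mem_W a b).1 hW).1, left_of_leftProd (S := R X) le_rfl ?_ l hl a b h⟩
      intro w hw
      obtain ⟨n, hn⟩ := Set.mem_iUnion.1 hw
      exact left_of_mem_Rn n w hn

theorem B_subset_W {X : Type u} [LinearOrder X] {x : P X} (hx : x ∈ B X) : x ∈ W X := by
  rcases hx with rfl | hx
  · exact one_mem_W X
  · exact hx.1

theorem redMul_mem_B {X : Type u} [LinearOrder X] {x : P X} {y : FreeMagma X} (hx : x ∈ B X)
    (hy : y ∈ R X) : redMul x y ∈ B X := by
  rcases redMul_cases y (B_subset_W hx) (R_subset_W hy) with ⟨c, -, h1, h⟩ | ⟨hW, h⟩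
  · rw [h]
    rw [h1] at hx
    exact left_mem_B hx
  · rw [h]
    rcases hx with hx | ⟨-, l, -, hl, h1⟩
    · have hx' : x = 1 := hx
      subst hx'
      exact Or.inr ⟨hW, [y], by simp, by simpa using hy, by simp [leftProd]⟩
    · refine Or.inr ⟨hW, l ++ [y], by simp, ?_, by rw [leftProd_concat, h1]⟩
      intro a ha
      rcases List.mem_append.1 ha with ha | ha
      · exact hl a ha
      · rw [List.mem_singleton.1 ha]
        exact hy

theorem redFold_mem_B {X : Type u} [LinearOrder X] (l : List (FreeMagma X)) :
    ∀ x ∈ B X, (∀ a ∈ l, a ∈ R X) → redFold x l ∈ B X := by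
  induction l with
  | nil => intro x hx _; exact hx
  | cons b l ih =>
    intro x hx hl
    exact ih (redMul x b) (redMul_mem_B hx (hl b (by simp))) (fun a ha => hl a (by simp [ha]))

theorem redFold_reverse {X : Type u} [LinearOrder X] (l : List (FreeMagma X)) :
    ∀ x ∈ B X, (∀ a ∈ l, a ∈ R X) → redFold (redFold x l) l.reverse = x := by
  induction l with
  | nil => intro x _ _; rfl
  | cons b l ih =>
    intro x hx hl
    have h1 : redFold x (b :: l) = redFold (redMul x b) l := rfl
    have h2 : ∀ z : P X, redFold z (b :: l).reverse = redMul (redFold z l.reverse) b := by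
      intro z
      simp [redFold]
    have hb := hl b (by simp)
    rw [h1, h2, ih (redMul x b) (redMul_mem_B hx hb) (fun a ha => hl a (by simp [ha])),
      redMul_redMul (B_subset_W hx) (R_subset_W hb)]

theorem palin_reverse {A : Type u} (l : List A) : (palin l).reverse = palin l := by
  induction l using List.reverseRecOn with
  | nil => rfl
  | append_singleton l b _ => simp [palin]

theorem mem_of_mem_palin {A : Type u} {l : List A} {a : A} (h : a ∈ palin l) : a ∈ l := by
  rcases List.mem_append.1 h with h | h
  · exact h
  · exact List.mem_reverse.1 (List.mem_of_mem_tail h)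

theorem isSymRep_symList {X : Type u} [LinearOrder X] {y : FreeMagma X} (hy : y ∈ R X) :
    IsSymRep (y : P X) (symList (y : P X)) := by
  have h : ∃ l, IsSymRep (y : P X) l := by
    refine ⟨[y], by simp, by simpa using hy, by simp, ?_⟩
    have : leftProd (1 : P X) (palin [y]) = (y : P X) := by simp [leftProd, palin]
    rw [this, pi_of_mem_W (R_subset_W hy)]
  rw [symList, dif_pos h]
  exact h.choose_spec

theorem circ_eq {X : Type u} [LinearOrder X] {x : P X} {y : FreeMagma X} (hx : x ∈ B X)
    (hy : y ∈ R X) : circ x (y : P X) = redFold x (palin (symList (y : P X))) := by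
  obtain ⟨-, h1, -, h2⟩ := isSymRep_symList hy
  have h3 : ∀ a ∈ palin (symList (y : P X)), (a : P X) ∈ W X :=
    fun a ha => R_subset_W (h1 a (mem_of_mem_palin ha))
  rw [circ, if_neg WithOne.coe_ne_one]
  split_ifs with h
  · subst h
    rw [← pi_leftProd _ 1 (one_mem_W X) h3]
    exact h2
  · exact pi_leftProd _ x (B_subset_W hx) h3

theorem circ_mem_B {X : Type u} [LinearOrder X] {x : P X} {y : FreeMagma X} (hx : x ∈ B X)
    (hy : y ∈ R X) : circ x (y : P X) ∈ B X := by
  rw [circ_eq hx hy]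
  exact redFold_mem_B _ x hx fun a ha => (isSymRep_symList hy).2.1 a (mem_of_mem_palin ha)

theorem circ_circ {X : Type u} [LinearOrder X] {x : P X} {y : FreeMagma X} (hx : x ∈ B X)
    (hy : y ∈ R X) : circ (circ x (y : P X)) (y : P X) = x := by
  rw [circ_eq (circ_mem_B hx hy) hy, circ_eq hx hy]
  have h := redFold_reverse (palin (symList (y : P X))) x hx
    fun a ha => (isSymRep_symList hy).2.1 a (mem_of_mem_palin ha)
  rwa [palin_reverse] at h

/-! The group `G`, its right action on `B(X)`, and the stabilizer `H` of the empty word. -/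

/-- The permutation `b ↦ b ∘ y` of `B(X)`, for `y ∈ R(X)`. -/
def rightMul {X : Type u} [LinearOrder X] (y : R X) : Equiv.Perm (B X) where
  toFun b := ⟨circ b.1 (y.1 : P X), circ_mem_B b.2 y.2⟩
  invFun b := ⟨circ b.1 (y.1 : P X), circ_mem_B b.2 y.2⟩
  left_inv b := Subtype.ext (circ_circ b.2 y.2)
  right_inv b := Subtype.ext (circ_circ b.2 y.2)

theorem rightMul_mul_self {X : Type u} [LinearOrder X] (y : R X) :
    rightMul y * rightMul y = 1 :=
  Equiv.ext fun b => Subtype.ext (circ_circ b.2 y.2)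

/-- The free product of the groups `⟨R_y | R_y² = 1⟩` of order two, `y ∈ R(X)`. -/
abbrev G (X : Type u) [LinearOrder X] : Type u :=
  Monoid.CoprodI (fun _ : R X => Multiplicative (ZMod 2))

/-- The generator `R_y` of `G`. -/
def gen {X : Type u} [LinearOrder X] (y : R X) : G X :=
  Monoid.CoprodI.of (M := fun _ : R X => Multiplicative (ZMod 2)) (i := y)
    (Multiplicative.ofAdd (1 : ZMod 2))

/-- The homomorphism from a group of order two that sends the generator to the involution `p`. -/
def homOfInvolution {M : Type u} [Group M] (p : M) (hp : p * p = 1) :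
    Multiplicative (ZMod 2) →* M where
  toFun a := p ^ (Multiplicative.toAdd a).val
  map_one' := by simp
  map_mul' a b := by
    rw [toAdd_mul, ZMod.val_add, ← pow_add]
    exact (pow_eq_pow_mod _ (by rw [pow_two, hp])).symm

/-- The right action of `G` on `B(X)` determined by `b R_y = b ∘ y`, as a homomorphism to the
opposite of the group of permutations. -/
def act (X : Type u) [LinearOrder X] : G X →* (Equiv.Perm (B X))ᵐᵒᵖ :=
  Monoid.CoprodI.lift fun y => homOfInvolution (MulOpposite.op (rightMul y))
    (by rw [← MulOpposite.op_mul, rightMul_mul_self, MulOpposite.op_one])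

/-- The image of `b ∈ B(X)` under `g ∈ G`. -/
def apply {X : Type u} [LinearOrder X] (b : B X) (g : G X) : B X := (act X g).unop b

theorem apply_one {X : Type u} [LinearOrder X] (b : B X) : apply b 1 = b := by
  simp [apply]

theorem apply_mul {X : Type u} [LinearOrder X] (b : B X) (g h : G X) :
    apply b (g * h) = apply (apply b g) h := by
  simp [apply]

theorem apply_gen {X : Type u} [LinearOrder X] (b : B X) (y : R X) :
    (apply b (gen y) : P X) = circ (b : P X) (y.1 : P X) := by
  have h : (Multiplicative.toAdd (Multiplicative.ofAdd (1 : ZMod 2))).val = 1 := rfl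
  simp only [apply, act, gen, Monoid.CoprodI.lift_of, homOfInvolution, MonoidHom.coe_mk,
    OneHom.coe_mk, h, pow_one, MulOpposite.unop_op]
  rfl

/-- The empty word as an element of `B(X)`. -/
def emptyWord (X : Type u) [LinearOrder X] : B X := ⟨1, Or.inl rfl⟩

/-- The stabilizer of the empty word in `G`. -/
def H (X : Type u) [LinearOrder X] : Subgroup (G X) where
  carrier := {g | apply (emptyWord X) g = emptyWord X}
  one_mem' := apply_one _
  mul_mem' {g h} hg hh := by
    change apply _ (g * h) = _
    rw [apply_mul, show apply (emptyWord X) g = emptyWord X from hg]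
    exact hh
  inv_mem' {g} hg := by
    change apply _ g⁻¹ = _
    have h := apply_mul (emptyWord X) g g⁻¹
    rw [mul_inv_cancel, apply_one, show apply (emptyWord X) g = emptyWord X from hg] at h
    exact h.symm

end

end FreeBol

namespace FreeBol

/-! The largest normal subgroup of `G` inside `H` is the kernel of the action on the orbit of the
empty word, so it suffices that every nontrivial `g` in `G` moves some word of that orbit
(`exists_apply_apply_ne`). Write `g` as a product of generators with distinct neighbours. The
decisive fact is that `y ∈ R X` acts by the plain product rule, `x ∘ y = π(xy)` (`circ_eq_redMul`).
A sufficiently long word of the orbit whose last letter differs from the first factor of `g` then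
has nothing to cancel against: it only grows under `g`, hence is moved.

The decisive fact says that `y ∈ R X` has only the symmetric representation `[y]`
(`IsSymRep.eq_singleton`). If `y = π(w k wʳ)` with `w` a nonempty list, then `wʳ` carries `u = π(w)`
to the empty word and, at the same time, `π(uk)` to `y`. Such a pair of targets is excluded by
following both words along the list (`not_isGenPair_redFold_mul`). A proper product whose last
factor differs from the next one grows until it equals the next factor, and then it vanishes. That
factor is not a letter, so once the other word has been extended by it, the result lies outside `R
X`, and the argument repeats with the roles exchanged (`not_isGenPair_redFold_one`).

Three properties of the elements `z ∈ R X` that are not letters enter: `z` ends with a letter; `tr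
z` is reduced and different from `z`; and `tr z` is not in `R X`. -/

variable {X : Type*}

/-! Lengths and factors of words, the empty word included. -/

/-- The number of letters of a word. -/
def len (v : P X) : ℕ := WithOne.recOneCoe (motive := fun _ => ℕ) 0 FreeMagma.length v

/-- The list of factors of a word; the empty word has none. -/
def factorList (v : P X) : List (FreeMagma X) :=
  WithOne.recOneCoe (motive := fun _ => List (FreeMagma X)) [] factors v

@[simp] theorem len_one : len (1 : P X) = 0 := rfl

@[simp] theorem len_coe (a : FreeMagma X) : len (a : P X) = a.length := rfl

@[simp] theorem len_mul_coe (a : P X) (b : FreeMagma X) :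
    len (a * (b : P X)) = len a + b.length := by
  induction a using WithOne.recOneCoe with
  | one => simp
  | coe a => rfl

theorem len_pos {a : P X} (h : a ≠ 1) : 0 < len a := by
  induction a using WithOne.recOneCoe with
  | one => exact absurd rfl h
  | coe a => exact a.length_pos

theorem mul_coe_ne_one (a : P X) (b : FreeMagma X) : a * (b : P X) ≠ 1 := by
  intro h
  have h1 := congrArg len h
  have := b.length_pos
  simp at h1
  omega

theorem mul_coe_inj {a c : P X} {b d : FreeMagma X} (ha : a ≠ 1) (hc : c ≠ 1)
    (h : a * (b : P X) = c * (d : P X)) : a = c ∧ b = d := by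
  obtain ⟨a, rfl⟩ := WithOne.ne_one_iff_exists.1 ha
  obtain ⟨c, rfl⟩ := WithOne.ne_one_iff_exists.1 hc
  rw [← WithOne.coe_mul, ← WithOne.coe_mul, WithOne.coe_inj] at h
  rw [(mul_inj' h).1, (mul_inj' h).2]
  exact ⟨rfl, rfl⟩

theorem mul_coe_ne_of {c : P X} (hc : c ≠ 1) (b : FreeMagma X) (x : X) :
    c * (b : P X) ≠ (FreeMagma.of x : FreeMagma X) := by
  obtain ⟨c, rfl⟩ := WithOne.ne_one_iff_exists.1 hc
  rw [← WithOne.coe_mul, ne_eq, WithOne.coe_inj]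
  intro h
  cases h

/-! ### Products that cancel and products that grow. -/

theorem len_redMul_le (a : P X) (b : FreeMagma X) :
    len (redMul a b) ≤ len a + b.length := by
  by_cases h : ∃ c, a = c * (b : P X)
  · obtain ⟨c, rfl⟩ := h
    rw [redMul_mul, len_mul_coe]
    omega
  · rw [redMul_of_not h, len_mul_coe]

theorem redMul_of_len_lt {a : P X} {b : FreeMagma X} (h : len a < b.length) :
    redMul a b = a * (b : P X) := by
  apply redMul_of_not
  rintro ⟨c, rfl⟩
  rw [len_mul_coe] at h
  omega

/-- If `a` ended in `b`, then `a * b` would be one of the forbidden words `bb` and `(cb)b`. -/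
theorem redMul_of_mul_mem_W {a : P X} {b : FreeMagma X} (h : a * (b : P X) ∈ W X) :
    redMul a b = a * (b : P X) := by
  apply redMul_of_not
  rintro ⟨c, rfl⟩
  have hW : ∀ c : P X, c * (b : P X) * (b : P X) ∉ W X := by
    intro c h
    induction c using WithOne.recOneCoe with
    | one =>
      rw [one_mul, ← WithOne.coe_mul, mul_mem_W] at h
      exact h.2.2.1 rfl
    | coe c =>
      rw [← WithOne.coe_mul, ← WithOne.coe_mul, mul_mem_W] at h
      exact h.2.2.2 c rfl
  exact hW c h

/-- Multiplication of a proper product by something else than its last factor. -/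
theorem redMul_mul_of_ne {c : P X} (hc : c ≠ 1) {b g : FreeMagma X} (hb : b ≠ g)
    (h : c * (b : P X) ≠ g) : redMul (c * (b : P X)) g = c * (b : P X) * (g : P X) := by
  apply redMul_of_not
  rintro ⟨d, hd⟩
  by_cases h1 : d = 1
  · rw [h1, one_mul] at hd
    exact h hd
  · exact hb (mul_coe_inj hc h1 hd).2

/-! ### Iterated products, with and without reduction. -/

theorem leftProd_nil (v : P X) : leftProd v [] = v := rfl

theorem leftProd_cons (v : P X) (b : FreeMagma X) (l : List (FreeMagma X)) :
    leftProd v (b :: l) = leftProd (v * (b : P X)) l := rfl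

theorem redFold_nil (v : P X) : redFold v [] = v := rfl

theorem redFold_cons (v : P X) (b : FreeMagma X) (l : List (FreeMagma X)) :
    redFold v (b :: l) = redFold (redMul v b) l := rfl

theorem redFold_append (v : P X) (l l' : List (FreeMagma X)) :
    redFold v (l ++ l') = redFold (redFold v l) l' := by simp [redFold]

theorem leftProd_ne_one_of_ne {v : P X} (hv : v ≠ 1) (l : List (FreeMagma X)) :
    leftProd v l ≠ 1 := by
  induction l using List.reverseRecOn with
  | nil => exact hv
  | append_singleton l b _ => exact leftProd_ne_one v l b

theorem leftProd_ne_one_of_ne_nil (v : P X) {l : List (FreeMagma X)} (hl : l ≠ []) :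
    leftProd v l ≠ 1 := by
  obtain ⟨l', b, rfl⟩ := (List.eq_nil_or_concat l).resolve_left hl
  rw [List.concat_eq_append]
  exact leftProd_ne_one v l' b

theorem len_leftProd (v : P X) (l : List (FreeMagma X)) :
    len (leftProd v l) = len v + (l.map FreeMagma.length).sum := by
  induction l generalizing v with
  | nil => rfl
  | cons b l ih => rw [leftProd_cons, ih, len_mul_coe, List.map_cons, List.sum_cons, add_assoc]

theorem len_redFold_le (v : P X) (l : List (FreeMagma X)) :
    len (redFold v l) ≤ len v + (l.map FreeMagma.length).sum := by
  induction l generalizing v with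
  | nil => exact le_rfl
  | cons b l ih =>
    have h1 := ih (redMul v b)
    have h2 := len_redMul_le v b
    rw [redFold_cons, List.map_cons, List.sum_cons]
    omega

theorem leftProd_mem_W_of_append {v : P X} {l l' : List (FreeMagma X)}
    (h : leftProd v (l ++ l') ∈ W X) : leftProd v l ∈ W X := by
  induction l' using List.reverseRecOn with
  | nil => rwa [List.append_nil] at h
  | append_singleton l' b ih =>
    refine ih ?_
    rw [← List.append_assoc, leftProd_concat] at h
    by_cases h1 : leftProd v (l ++ l') = 1
    · rw [h1]; exact one_mem_W X
    · obtain ⟨a, ha⟩ := WithOne.ne_one_iff_exists.1 h1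
      rw [← ha, ← WithOne.coe_mul, mul_mem_W] at h
      rw [← ha]
      exact h.1

theorem redFold_mem_W {l : List (FreeMagma X)} {v : P X} (hv : v ∈ W X)
    (hl : ∀ a ∈ l, (a : P X) ∈ W X) : redFold v l ∈ W X := by
  induction l generalizing v with
  | nil => exact hv
  | cons b l ih =>
    exact ih (redMul_mem_W hv (hl b (by simp))) fun a ha => hl a (by simp [ha])

/-- Each reduced factor acts as an involution on all of `W X`. Working in `W X` rather than `B X`
avoids having to track membership in `B X`. -/
theorem redFold_redFold_reverse {l : List (FreeMagma X)} {v : P X} (hv : v ∈ W X)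
    (hl : ∀ a ∈ l, (a : P X) ∈ W X) : redFold (redFold v l) l.reverse = v := by
  induction l generalizing v with
  | nil => rfl
  | cons b l ih =>
    have hb := hl b (by simp)
    rw [redFold_cons, List.reverse_cons, redFold_append,
      ih (redMul_mem_W hv hb) fun a ha => hl a (by simp [ha]), redFold_cons, redFold_nil,
      redMul_redMul hv hb]

/-! Factors and transposition. -/

@[simp] theorem factorList_coe (a : FreeMagma X) : factorList (a : P X) = factors a := rfl

theorem factorList_mul_coe {a : P X} (ha : a ≠ 1) (b : FreeMagma X) :
    factorList (a * (b : P X)) = factorList a ++ [b] := by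
  obtain ⟨a, rfl⟩ := WithOne.ne_one_iff_exists.1 ha
  rfl

theorem factorList_leftProd {v : P X} (hv : v ≠ 1) (l : List (FreeMagma X)) :
    factorList (leftProd v l) = factorList v ++ l := by
  induction l generalizing v with
  | nil => simp [leftProd_nil]
  | cons b l ih =>
    rw [leftProd_cons, ih (mul_coe_ne_one v b), factorList_mul_coe hv, List.append_assoc,
      List.singleton_append]

theorem factorList_leftProd_of (x : X) (l : List (FreeMagma X)) :
    factorList (leftProd 1 (FreeMagma.of x :: l)) = FreeMagma.of x :: l := by
  rw [leftProd_cons, one_mul, factorList_leftProd WithOne.coe_ne_one]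
  rfl

theorem exists_factors_eq (y : FreeMagma X) : ∃ x l, factors y = FreeMagma.of x :: l := by
  induction y with
  | ih1 x => exact ⟨x, [], rfl⟩
  | ih2 a b iha _ =>
    obtain ⟨x, l, h⟩ := iha
    refine ⟨x, l ++ [b], ?_⟩
    change factors a ++ [b] = _
    rw [h, List.cons_append]

theorem leftProd_factors (y : FreeMagma X) : leftProd 1 (factors y) = (y : P X) := by
  induction y with
  | ih1 x => simp [factors, leftProd]
  | ih2 a b iha _ =>
    change leftProd 1 (factors a ++ [b]) = ((a * b : FreeMagma X) : P X)
    rw [leftProd_concat, iha, WithOne.coe_mul]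

theorem coe_tr (y : FreeMagma X) : (tr y : P X) = leftProd 1 (factors y).reverse := by
  have h : ∀ (l : List (FreeMagma X)) (b : FreeMagma X),
      ((l.foldl (fun p q => p * q) b : FreeMagma X) : P X) = leftProd (b : P X) l := by
    intro l
    induction l with
    | nil => intro b; rfl
    | cons a l ih => intro b; rw [List.foldl_cons, ih, leftProd_cons, WithOne.coe_mul]
  cases y with
  | of x => simp [tr, factors, leftProd]
  | mul a b =>
    rw [tr, h, factors, List.reverse_append, List.reverse_singleton, List.singleton_append,
      leftProd_cons, one_mul]

theorem factors_tr_mul (a b : FreeMagma X) :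
    factors (tr (a * b)) = factors b ++ (factors a).reverse := by
  have h1 : factors (a * b) = factors a ++ [b] := rfl
  rw [← factorList_coe, coe_tr, h1, List.reverse_append, List.reverse_singleton,
    List.singleton_append, leftProd_cons, one_mul, factorList_leftProd WithOne.coe_ne_one,
    factorList_coe]

/-- Since the first factor of `a` is a letter, `tr (a * b)` ends with a letter, and the second
transposition is a plain reversal. Only the last factor `b` gets broken up. -/
theorem factors_tr_tr_mul (a b : FreeMagma X) :
    factors (tr (tr (a * b))) = factors a ++ (factors b).reverse := by
  obtain ⟨x, l, h⟩ := exists_factors_eq a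
  rw [← factorList_coe, coe_tr, factors_tr_mul, List.reverse_append, List.reverse_reverse, h,
    List.cons_append, factorList_leftProd_of]

theorem factors_injective : Function.Injective (factors (X := X)) := by
  intro a b h
  rw [← WithOne.coe_inj, ← leftProd_factors a, h, leftProd_factors]

theorem tr_tr_tr (y : FreeMagma X) : tr (tr (tr y)) = tr y := by
  cases y with
  | of x => rfl
  | mul a b =>
    change tr (tr (tr (a * b))) = tr (a * b)
    obtain ⟨x, l, h⟩ := exists_factors_eq b
    have h1 : factors (tr (tr (a * b))) = factors a ++ (factors b).reverse :=
      factors_tr_tr_mul a b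
    apply factors_injective
    rw [← factorList_coe, coe_tr, h1, List.reverse_append, List.reverse_reverse, factors_tr_mul,
      h, List.cons_append, factorList_leftProd_of]

theorem eq_of_of_factors_eq_singleton {a b : FreeMagma X} (h : factors a = [b]) :
    ∃ x, a = FreeMagma.of x := by
  cases a with
  | of x => exact ⟨x, rfl⟩
  | mul c d =>
    obtain ⟨x, l, h1⟩ := exists_factors_eq c
    rw [factors, h1] at h
    simp at h

/-- Double transposition replaces the last factor `b` by the reversed list of its own factors; being
fixed forces that list to have a single entry. -/
theorem eq_of_of_tr_tr_mul {a b : FreeMagma X} (h : tr (tr (a * b)) = a * b) :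
    ∃ x, b = FreeMagma.of x := by
  have h1 := factors_tr_tr_mul a b
  have h2 : factors (a * b) = factors a ++ [b] := rfl
  rw [h, h2, List.append_cancel_left_eq] at h1
  refine eq_of_of_factors_eq_singleton (b := b) ?_
  rw [← List.reverse_reverse (factors b), ← h1, List.reverse_singleton]

/-! The order of words. -/

theorem wordLT_irrefl [LinearOrder X] (a : FreeMagma X) : ¬ wordLT a a := by
  induction a with
  | ih1 x => exact lt_irrefl x
  | ih2 a b iha ihb =>
    rintro (h | ⟨-, h | ⟨-, h⟩⟩)
    · exact lt_irrefl _ h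
    · exact ihb h
    · exact iha h

theorem wordLT_asymm [LinearOrder X] {a b : FreeMagma X} (h : wordLT a b) : ¬ wordLT b a := by
  induction a generalizing b with
  | ih1 x =>
    cases b with
    | of y => exact lt_asymm (α := X) h
    | mul c d => exact id
  | ih2 a b iha ihb =>
    cases b with
    | of y => exact absurd h id
    | mul c d =>
      rintro (h' | ⟨h1, h'⟩)
      · rcases h with h | ⟨h, -⟩
        · exact lt_asymm h h'
        · exact absurd h.symm h'.ne
      · rcases h with h | ⟨-, h⟩
        · exact absurd h1.symm h.ne
        · rcases h with h | ⟨e, h⟩ <;> rcases h' with h' | ⟨e', h'⟩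
          · exact ihb h h'
          · rw [e'] at h; exact wordLT_irrefl _ h
          · rw [e] at h'; exact wordLT_irrefl _ h'
          · exact iha h h'

theorem wordLT_trichotomy [LinearOrder X] (a b : FreeMagma X) :
    wordLT a b ∨ a = b ∨ wordLT b a := by
  induction a generalizing b with
  | ih1 x =>
    cases b with
    | of y =>
      rcases lt_trichotomy x y with h | h | h
      · exact Or.inl h
      · exact Or.inr (Or.inl (by rw [h]))
      · exact Or.inr (Or.inr h)
    | mul c d => exact Or.inl trivial
  | ih2 a a' iha iha' =>
    cases b with
    | of y => exact Or.inr (Or.inr trivial)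
    | mul c d =>
      rcases lt_trichotomy (a * a').length (c * d).length with h | h | h
      · exact Or.inl (Or.inl h)
      · rcases iha' d with h1 | h1 | h1
        · exact Or.inl (Or.inr ⟨h, Or.inl h1⟩)
        · rcases iha c with h2 | h2 | h2
          · exact Or.inl (Or.inr ⟨h, Or.inr ⟨h1, h2⟩⟩)
          · exact Or.inr (Or.inl (by rw [h1, h2]; rfl))
          · exact Or.inr (Or.inr (Or.inr ⟨h.symm, Or.inr ⟨h1.symm, h2⟩⟩))
        · exact Or.inr (Or.inr (Or.inr ⟨h.symm, Or.inl h1⟩))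
      · exact Or.inr (Or.inr (Or.inl h))

/-! Elements of `D` and `R`. -/

/-- `rep y` is `tr y` or `tr (tr y)`, and on transposes `tr` is an involution. -/
theorem tr_tr_of_mem_D [LinearOrder X] {z : FreeMagma X} (hz : z ∈ D X) : tr (tr z) = z := by
  obtain ⟨y, rfl, -⟩ := hz
  unfold rep wordMin
  split_ifs <;> simp only [tr_tr_tr]

theorem not_wordLT_tr_of_mem_D [LinearOrder X] {z : FreeMagma X} (hz : z ∈ D X) :
    ¬ wordLT (tr z) z := by
  obtain ⟨y, rfl, -⟩ := hz
  unfold rep wordMin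
  split_ifs with h
  · rw [tr_tr_tr]
    exact wordLT_asymm h
  · exact h

theorem mem_R_cases [LinearOrder X] {z : FreeMagma X} (hz : z ∈ R X) :
    (∃ x, z = FreeMagma.of x) ∨ z ∈ D X := by
  obtain ⟨n, hn⟩ := Set.mem_iUnion.1 hz
  induction n with
  | zero => exact absurd hn (Set.notMem_empty z)
  | succ n ih =>
    cases n with
    | zero =>
      obtain ⟨x, rfl⟩ := hn
      exact Or.inl ⟨x, rfl⟩
    | succ n =>
      rcases hn with hn | hn
      · exact ih hn
      · exact Or.inr hn.1

theorem of_mem_R [LinearOrder X] (x : X) : FreeMagma.of x ∈ R X :=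
  Set.mem_iUnion.2 ⟨1, x, rfl⟩

theorem mul_mem_D_of_mem_R [LinearOrder X] {a b : FreeMagma X} (h : a * b ∈ R X) :
    a * b ∈ D X := by
  rcases mem_R_cases h with ⟨x, hx⟩ | h
  · cases hx
  · exact h

theorem tr_mem_W_of_mem_D [LinearOrder X] {z : FreeMagma X} (hz : z ∈ D X) :
    (tr z : P X) ∈ W X := by
  obtain ⟨y, rfl, -, -, h, -⟩ := hz
  exact h

theorem tr_ne_of_mem_D [LinearOrder X] {z : FreeMagma X} (hz : z ∈ D X) : tr z ≠ z := by
  obtain ⟨y, rfl, -, -, -, h⟩ := hz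
  exact h

/-- Transposition pairs `z` with the different word `tr z`, and `D X` contains only the smaller of
the two. A letter `tr z` would be its own transpose and so equal to `z`. -/
theorem tr_notMem_R_of_mem_D [LinearOrder X] {z : FreeMagma X} (hz : z ∈ D X) :
    tr z ∉ R X := by
  intro h
  have h1 := tr_tr_of_mem_D hz
  have h2 : tr z ∈ D X := by
    rcases mem_R_cases h with ⟨x, hx⟩ | h
    · rw [hx] at h1
      exact absurd (hx.trans h1) (tr_ne_of_mem_D hz)
    · exact h
  have h3 := not_wordLT_tr_of_mem_D h2
  rw [h1] at h3
  rcases wordLT_trichotomy z (tr z) with h4 | h4 | h4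
  · exact h3 h4
  · exact tr_ne_of_mem_D hz h4.symm
  · exact not_wordLT_tr_of_mem_D hz h4

/-- Proper products in `R(X)` end with a letter. -/
theorem eq_of_of_mul_mem_R [LinearOrder X] {a b : FreeMagma X} (h : a * b ∈ R X) :
    ∃ x, b = FreeMagma.of x :=
  eq_of_of_tr_tr_mul (tr_tr_of_mem_D (mul_mem_D_of_mem_R h))

theorem exists_mul_of_coe_eq {c : P X} (hc : c ≠ 1) {b z : FreeMagma X}
    (h : c * (b : P X) = z) : ∃ a : FreeMagma X, c = a ∧ z = a * b := by
  obtain ⟨a, rfl⟩ := WithOne.ne_one_iff_exists.1 hc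
  rw [← WithOne.coe_mul, WithOne.coe_inj] at h
  exact ⟨a, rfl, h.symm⟩

theorem eq_of_of_mul_coe_eq [LinearOrder X] {c : P X} (hc : c ≠ 1) {b z : FreeMagma X}
    (hz : z ∈ R X) (h : c * (b : P X) = z) : ∃ x, b = FreeMagma.of x := by
  obtain ⟨a, -, rfl⟩ := exists_mul_of_coe_eq hc h
  exact eq_of_of_mul_mem_R hz

theorem mem_D_of_leftProd_eq [LinearOrder X] {v : P X} (hv : v ≠ 1) {l : List (FreeMagma X)}
    (hl : l ≠ []) {z : FreeMagma X} (hz : z ∈ R X) (h : leftProd v l = z) : z ∈ D X := by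
  obtain ⟨l, b, rfl⟩ := (List.eq_nil_or_concat l).resolve_left hl
  rw [List.concat_eq_append, leftProd_concat] at h
  obtain ⟨a, -, rfl⟩ := exists_mul_of_coe_eq (leftProd_ne_one_of_ne hv l) h
  exact mul_mem_D_of_mem_R hz

theorem redFold_one_eq_leftProd [LinearOrder X] {l : List (FreeMagma X)} (hl : ∀ a ∈ l, a ∈ R X)
    (h : leftProd 1 l ∈ W X) : redFold 1 l = leftProd 1 l := by
  rw [← pi_leftProd l 1 (one_mem_W X) fun a ha => R_subset_W (hl a ha), pi_of_mem_W h]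

/-- The product of the reversed list is an initial part of `tr z`, which is reduced by the
definition of `D X`. -/
theorem leftProd_reverse_mem_W [LinearOrder X] {v : P X} (hv : v ≠ 1)
    {l : List (FreeMagma X)} {z : FreeMagma X} (hz : z ∈ D X) (h : leftProd v l = z) :
    leftProd 1 l.reverse ∈ W X := by
  have h1 := tr_mem_W_of_mem_D hz
  rw [coe_tr, ← factorList_coe, ← h, factorList_leftProd hv, List.reverse_append] at h1
  exact leftProd_mem_W_of_append h1

/-- The proper right parts of elements of `R(X)` do not fix the empty word. -/
theorem redFold_one_ne_one [LinearOrder X] {v : P X} (hv : v ≠ 1) {l : List (FreeMagma X)}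
    (hl : l ≠ []) (hR : ∀ a ∈ l, a ∈ R X) {z : FreeMagma X} (hz : z ∈ R X)
    (h : leftProd v l = z) : redFold 1 l ≠ 1 := by
  intro h1
  -- Running the list backwards from the empty word would return to the empty word, yet no
  -- cancellation occurs in that direction.
  have h2 := leftProd_reverse_mem_W hv (mem_D_of_leftProd_eq hv hl hz h) h
  have h3 := redFold_redFold_reverse (one_mem_W X) fun a ha => R_subset_W (hR a ha)
  rw [h1, redFold_one_eq_leftProd (fun a ha => hR a (List.mem_reverse.1 ha)) h2] at h3
  exact leftProd_ne_one_of_ne_nil 1 (by simpa using hl) h3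

/-- A proper product in `R(X)` is not of the form `u k s` where `s` leads from `u` to the empty
word. -/
theorem redFold_ne_one_of_leftProd_mul [LinearOrder X] {u : P X} (hu : u ∈ W X)
    {k : FreeMagma X} {l : List (FreeMagma X)} (hl : l ≠ []) (hR : ∀ a ∈ l, a ∈ R X)
    {z : FreeMagma X} (hz : z ∈ R X) (h : leftProd (u * (k : P X)) l = z) :
    redFold u l ≠ 1 := by
  intro h1
  have hk := mul_coe_ne_one u k
  have hD := mem_D_of_leftProd_eq hk hl hz h
  have h2 := leftProd_reverse_mem_W hk hD h
  have h3 := redFold_redFold_reverse hu fun a ha => R_subset_W (hR a ha)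
  rw [h1, redFold_one_eq_leftProd (fun a ha => hR a (List.mem_reverse.1 ha)) h2] at h3
  have hu1 : u ≠ 1 := by
    rw [← h3]
    exact leftProd_ne_one_of_ne_nil 1 (by simpa using hl)
  obtain ⟨l, b, rfl⟩ := (List.eq_nil_or_concat l).resolve_left hl
  rw [List.concat_eq_append] at *
  have h4 := h
  rw [leftProd_concat] at h4
  obtain ⟨x, rfl⟩ := eq_of_of_mul_coe_eq (leftProd_ne_one_of_ne hk l) hz h4
  -- The list ends with a letter, so its reversal is exactly the factor list of `u`. The factors of
  -- `z` then form a palindrome with centre `k`, which contradicts `tr z ≠ z`.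
  have h5 : factorList u = (l ++ [FreeMagma.of x]).reverse := by
    rw [← h3, List.reverse_append, List.reverse_singleton, List.singleton_append,
      factorList_leftProd_of]
  have h6 : factors z = (l ++ [FreeMagma.of x]).reverse ++ [k] ++ (l ++ [FreeMagma.of x]) := by
    rw [← factorList_coe, ← h, factorList_leftProd hk, factorList_mul_coe hu1, h5]
  apply tr_ne_of_mem_D hD
  rw [← WithOne.coe_inj, coe_tr, ← leftProd_factors z, h6]
  simp

/-! Simultaneous action on two words. -/

/-- One of the words is empty and the other one belongs to `R(X)`. -/
def IsGenPair [LinearOrder X] (a b : P X) : Prop :=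
  ∃ y ∈ R X, (a = 1 ∧ b = (y : P X)) ∨ (a = (y : P X) ∧ b = 1)

theorem IsGenPair.symm [LinearOrder X] {a b : P X} (h : IsGenPair a b) : IsGenPair b a := by
  obtain ⟨y, hy, h | h⟩ := h
  · exact ⟨y, hy, Or.inr ⟨h.2, h.1⟩⟩
  · exact ⟨y, hy, Or.inl ⟨h.2, h.1⟩⟩

theorem not_isGenPair_of_ne_one [LinearOrder X] {a b : P X} (ha : a ≠ 1) (hb : b ≠ 1) :
    ¬ IsGenPair a b := by
  rintro ⟨y, -, h | h⟩
  · exact ha h.1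
  · exact hb h.2

/-- A word grows under the action until it becomes equal to the next letter of the list. -/
theorem redFold_eq_leftProd_or {c : P X} (hc : c ≠ 1) {b : FreeMagma X}
    {s : List (FreeMagma X)} (hs : (b :: s).IsChain (· ≠ ·)) :
    redFold (c * (b : P X)) s = leftProd (c * (b : P X)) s ∨
      ∃ (s₁ : List (FreeMagma X)) (z : FreeMagma X) (s₂ : List (FreeMagma X)),
        s = s₁ ++ z :: s₂ ∧ leftProd (c * (b : P X)) s₁ = z ∧
        redFold (c * (b : P X)) s₁ = leftProd (c * (b : P X)) s₁ := by
  induction s generalizing c b with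
  | nil => exact Or.inl rfl
  | cons g s ih =>
    rw [List.isChain_cons_cons] at hs
    by_cases hg : c * (b : P X) = g
    · exact Or.inr ⟨[], g, s, rfl, hg, rfl⟩
    · have h1 := redMul_mul_of_ne hc hs.1 hg
      rcases ih (mul_coe_ne_one c b) hs.2 with h | ⟨s₁, z, s₂, rfl, h2, h3⟩
      · left
        rw [redFold_cons, h1, h, leftProd_cons]
      · refine Or.inr ⟨g :: s₁, z, s₂, rfl, ?_, ?_⟩
        · rw [leftProd_cons, h2]
        · rw [redFold_cons, h1, h3, leftProd_cons]

theorem redFold_eq_leftProd_or_of_redMul {w : P X} (hw : w ≠ 1) {g : FreeMagma X}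
    {s : List (FreeMagma X)} (hs : (g :: s).IsChain (· ≠ ·))
    (hg : redMul w g = w * (g : P X)) :
    redFold w (g :: s) = leftProd w (g :: s) ∨
      ∃ (s₁ : List (FreeMagma X)) (z : FreeMagma X) (s₂ : List (FreeMagma X)),
        s = s₁ ++ z :: s₂ ∧ leftProd w (g :: s₁) = z ∧
        redFold w (g :: s₁) = leftProd w (g :: s₁) := by
  simp only [redFold_cons, leftProd_cons, hg]
  exact redFold_eq_leftProd_or hw hs

/-- Applied after a collapse: the factor `b` at which one word vanished is a proper product, so the
other word leaves `R X`. -/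
theorem notMem_R_of_mul [LinearOrder X] {c : P X} (hc : c ≠ 1) {b z : FreeMagma X}
    (hb : ∀ x, b ≠ FreeMagma.of x) (h : c * (b : P X) = z) : z ∉ R X := by
  intro hz
  obtain ⟨x, hx⟩ := eq_of_of_mul_coe_eq hc hz h
  exact hb x hx

theorem ne_of_of_leftProd_eq {w : P X} (hw : w ≠ 1) {s : List (FreeMagma X)} (hs : s ≠ [])
    {z : FreeMagma X} (h : leftProd w s = z) (x : X) : z ≠ FreeMagma.of x := by
  rintro rfl
  obtain ⟨l, b, rfl⟩ := (List.eq_nil_or_concat s).resolve_left hs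
  rw [List.concat_eq_append, leftProd_concat] at h
  exact mul_coe_ne_of (leftProd_ne_one_of_ne hw l) b x h

theorem length_le_of_leftProd_eq {w : P X} {s : List (FreeMagma X)} {z : FreeMagma X}
    (h : leftProd w s = z) : len w + (s.map FreeMagma.length).sum = z.length := by
  rw [← len_leftProd, h, len_coe]

/-- A proper product that is not in `R(X)`, together with the empty word. -/
theorem not_isGenPair_redFold_one [LinearOrder X] {c : P X} (hc : c ≠ 1) {b : FreeMagma X}
    (hcb : ∀ z ∈ R X, c * (b : P X) ≠ (z : P X)) {s : List (FreeMagma X)}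
    (hs : (b :: s).IsChain (· ≠ ·)) (hR : ∀ a ∈ s, a ∈ R X) :
    ¬ IsGenPair (redFold (c * (b : P X)) s) (redFold 1 s) := by
  induction hn : s.length using Nat.strong_induction_on generalizing c b s with
  | _ n ih =>
    subst hn
    have hw := mul_coe_ne_one c b
    rcases redFold_eq_leftProd_or hc hs with h | ⟨s₁, z, s₂, rfl, h1, h2⟩
    · rw [h]
      rintro ⟨y, hy, ⟨h1, -⟩ | ⟨h1, h2⟩⟩
      · exact leftProd_ne_one_of_ne hw s h1
      · refine redFold_one_ne_one hw ?_ hR hy h1 h2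
        rintro rfl
        exact hcb y hy h1
    · have hz : z ∈ R X := hR z (by simp)
      have hs₁ : s₁ ≠ [] := by
        rintro rfl
        exact hcb z hz h1
      have hR₁ : ∀ a ∈ s₁, a ∈ R X := fun a ha => hR a (by simp [ha])
      -- At `z` the first word vanishes, while the second is nonempty and too short to cancel, so it
      -- is extended by the non-letter `z`. This is the initial situation with the words exchanged
      -- and a shorter list.
      have h3 := redFold_one_ne_one hw hs₁ hR₁ hz h1
      have h4 : len (redFold 1 s₁) < z.length := by
        have := len_redFold_le (1 : P X) s₁
        have := length_le_of_leftProd_eq h1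
        have := len_pos hw
        rw [len_one] at *
        omega
      rw [redFold_append, redFold_append, h2, h1, redFold_cons, redFold_cons, redMul_self,
        redMul_of_len_lt h4]
      intro h5
      refine ih s₂.length (by rw [List.length_append, List.length_cons]; omega) h3
        (fun y hy h => notMem_R_of_mul h3 (ne_of_of_leftProd_eq hw hs₁ h1) h hy)
        ?_ (fun a ha => hR a (by simp [ha])) rfl h5.symm
      exact (List.isChain_append.1 hs.tail).2.1

/-- A word `u k` and its left factor `u`. -/
theorem not_isGenPair_redFold_of_redMul [LinearOrder X] {u : P X} (hu : u ∈ W X)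
    {k g : FreeMagma X} (hg : redMul (u * (k : P X)) g = u * (k : P X) * (g : P X))
    {s : List (FreeMagma X)} (hs : (g :: s).IsChain (· ≠ ·)) (hR : ∀ a ∈ g :: s, a ∈ R X) :
    ¬ IsGenPair (redFold (u * (k : P X)) (g :: s)) (redFold u (g :: s)) := by
  have hw := mul_coe_ne_one u k
  rcases redFold_eq_leftProd_or_of_redMul hw hs hg with h | ⟨s₁, z, s₂, rfl, h1, h2⟩
  · rw [h]
    rintro ⟨y, hy, ⟨h1, -⟩ | ⟨h1, h2⟩⟩
    · exact leftProd_ne_one_of_ne hw _ h1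
    · exact redFold_ne_one_of_leftProd_mul hu (by simp) hR hy h1 h2
  · have hz : z ∈ R X := hR z (by simp)
    have h3 : redFold u (g :: s₁) ≠ 1 := redFold_ne_one_of_leftProd_mul hu (by simp)
      (fun a ha => hR a (by rw [← List.cons_append]; exact List.mem_append_left _ ha)) hz h1
    have h4 : len (redFold u (g :: s₁)) < z.length := by
      have := len_redFold_le u (g :: s₁)
      have := length_le_of_leftProd_eq h1
      have := k.length_pos
      rw [len_mul_coe] at *
      omega
    rw [← List.cons_append, redFold_append, redFold_append, h2, h1, redFold_cons, redFold_cons,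
      redMul_self, redMul_of_len_lt h4]
    intro h5
    refine not_isGenPair_redFold_one h3
      (fun y hy h => notMem_R_of_mul h3 (ne_of_of_leftProd_eq hw (by simp) h1) h hy)
      ?_ (fun a ha => hR a (by simp [ha])) h5.symm
    rw [← List.cons_append] at hs
    exact (List.isChain_append.1 hs).2.1

/-- Two proper products with the same last factor. -/
theorem not_isGenPair_redFold_mul_mul [LinearOrder X] {c d : P X} (hc : c ≠ 1) (hd : d ≠ 1)
    (hcd : c ≠ d) {b : FreeMagma X} {s : List (FreeMagma X)}
    (hs : (b :: s).IsChain (· ≠ ·)) (hR : ∀ a ∈ s, a ∈ R X) :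
    ¬ IsGenPair (redFold (c * (b : P X)) s) (redFold (d * (b : P X)) s) := by
  induction s generalizing c d b with
  | nil => exact not_isGenPair_of_ne_one (mul_coe_ne_one c b) (mul_coe_ne_one d b)
  | cons g s ih =>
    rw [List.isChain_cons_cons] at hs
    have hR' : ∀ a ∈ s, a ∈ R X := fun a ha => hR a (by simp [ha])
    have hne : c * (b : P X) ≠ d * (b : P X) := fun h => hcd (mul_coe_right_inj h)
    -- One word equals `g` and vanishes; the other grows to a product ending in the non-letter `g`.
    have key : ∀ {c d : P X}, c ≠ 1 → d ≠ 1 → c * (b : P X) ≠ d * (b : P X) →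
        c * (b : P X) = g →
        ¬ IsGenPair (redFold (d * (b : P X)) (g :: s)) (redFold (c * (b : P X)) (g :: s)) := by
      intro c d hc hd hne h1
      have hg : ∀ x, g ≠ FreeMagma.of x := by
        rintro x rfl
        exact mul_coe_ne_of hc b x h1
      rw [redFold_cons, redFold_cons, h1, redMul_self,
        redMul_mul_of_ne hd hs.1 fun h => hne (h1.trans h.symm)]
      exact not_isGenPair_redFold_one (mul_coe_ne_one d b)
        (fun y hy h => notMem_R_of_mul (mul_coe_ne_one d b) hg h hy) hs.2 hR'
    by_cases h1 : c * (b : P X) = g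
    · exact fun h => key hc hd hne h1 h.symm
    by_cases h2 : d * (b : P X) = g
    · exact key hd hc hne.symm h2
    rw [redFold_cons, redFold_cons, redMul_mul_of_ne hc hs.1 h1, redMul_mul_of_ne hd hs.1 h2]
    exact ih (mul_coe_ne_one c b) (mul_coe_ne_one d b) hne hs.2 hR'

/-- A left-normed product of a list starting with a letter grows when multiplied by something
else than its last factor. -/
theorem redMul_leftProd_concat {l : List (FreeMagma X)} {b g : FreeMagma X}
    (hl : ∃ x t, l ++ [b] = FreeMagma.of x :: t) (hb : b ≠ g)
    (h : leftProd 1 (l ++ [b]) ≠ g) :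
    redMul (leftProd 1 (l ++ [b])) g = leftProd 1 (l ++ [b]) * (g : P X) := by
  by_cases hn : l = []
  · subst hn
    obtain ⟨x, t, hx⟩ := hl
    rw [List.nil_append, List.cons.injEq] at hx
    obtain ⟨rfl, -⟩ := hx
    simp only [leftProd_concat, leftProd_nil, one_mul] at *
    apply redMul_of_not
    rintro ⟨d, hd⟩
    by_cases h1 : d = 1
    · rw [h1, one_mul] at hd
      exact h hd
    · exact mul_coe_ne_of h1 g x hd.symm
  · rw [leftProd_concat] at *
    exact redMul_mul_of_ne (leftProd_ne_one_of_ne_nil 1 hn) hb h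

/-- A one-element list would give `b = g`; hence `g` is a proper product. -/
theorem ne_of_of_leftProd_concat {l : List (FreeMagma X)} {b g : FreeMagma X} (hb : b ≠ g)
    (h : leftProd 1 (l ++ [b]) = g) (x : X) : g ≠ FreeMagma.of x := by
  by_cases hn : l = []
  · subst hn
    rw [leftProd_concat, leftProd_nil, one_mul, WithOne.coe_inj] at h
    exact absurd h hb
  · rintro rfl
    rw [leftProd_concat] at h
    exact mul_coe_ne_of (leftProd_ne_one_of_ne_nil 1 hn) b x h

/-! ### Splitting the factor list of an element of `D X`. -/

theorem exists_mul_of_mem_D [LinearOrder X] {k : FreeMagma X} (hk : k ∈ D X) :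
    ∃ a x, k = a * FreeMagma.of x := by
  cases k with
  | of x => exact absurd rfl (tr_ne_of_mem_D hk)
  | mul a b =>
    obtain ⟨x, rfl⟩ := eq_of_of_tr_tr_mul (tr_tr_of_mem_D hk)
    exact ⟨a, x, rfl⟩

theorem factors_tr_of_mem_D [LinearOrder X] {k : FreeMagma X} (hk : k ∈ D X) :
    factors (tr k) = (factors k).reverse := by
  obtain ⟨a, x, rfl⟩ := exists_mul_of_mem_D hk
  rw [factors_tr_mul]
  simp [factors]

theorem exists_of_cons_eq_of_factors {y b : FreeMagma X} {l m : List (FreeMagma X)}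
    (h : factors y = l ++ [b] ++ m) : ∃ x t, l ++ [b] = FreeMagma.of x :: t := by
  obtain ⟨x, r, hr⟩ := exists_factors_eq y
  rw [hr] at h
  cases l with
  | nil =>
    simp only [List.nil_append, List.singleton_append, List.cons.injEq] at h
    exact ⟨x, [], by rw [List.nil_append, h.1]⟩
  | cons p l =>
    simp only [List.cons_append, List.cons.injEq] at h
    exact ⟨x, l ++ [b], by rw [List.cons_append, h.1]⟩

/-- The left-normed products of the two complementary parts of the list of factors of an element
of `R(X)`, the second one taken in the opposite order. -/
theorem not_isGenPair_redFold_factors [LinearOrder X] {k : FreeMagma X} (hk : k ∈ D X)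
    {α β : List (FreeMagma X)} {b : FreeMagma X} (h : factors k = α ++ (β ++ [b]).reverse)
    {s : List (FreeMagma X)} (hs : (b :: s).IsChain (· ≠ ·)) (hR : ∀ a ∈ s, a ∈ R X) :
    ¬ IsGenPair (redFold (leftProd 1 α) s) (redFold (leftProd 1 (β ++ [b])) s) := by
  have htr := coe_tr k
  have hf := factors_tr_of_mem_D hk
  have hW := tr_mem_W_of_mem_D hk
  induction s generalizing α β b with
  | nil =>
    rw [redFold_nil, redFold_nil]
    rintro ⟨y, hy, ⟨h1, h2⟩ | ⟨-, h2⟩⟩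
    · have hα : α = [] := by
        by_contra hα
        exact leftProd_ne_one_of_ne_nil 1 hα h1
      subst hα
      -- With `α` empty, `β ++ [b]` is the whole reversed factor list of `k`, so its product is `tr
      -- k`.
      rw [h, List.nil_append, List.reverse_reverse, h2, WithOne.coe_inj] at htr
      exact tr_notMem_R_of_mem_D hk (htr ▸ hy)
    · exact leftProd_ne_one 1 β b h2
  | cons g s ih =>
    rw [List.isChain_cons_cons] at hs
    have hR' : ∀ a ∈ s, a ∈ R X := fun a ha => hR a (by simp [ha])
    have hg := hR g (by simp)
    have htr' := htr
    have hf' := hf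
    rw [h, List.reverse_append, List.reverse_reverse] at htr' hf'
    have hβ1 := leftProd_ne_one 1 β b
    obtain rfl | ⟨α, t, rfl⟩ := List.eq_nil_or_concat α
    · rw [List.reverse_nil, List.append_nil] at htr'
      have hβ : β ≠ [] := by
        rintro rfl
        obtain ⟨x, rfl⟩ := eq_of_of_factors_eq_singleton (b := b) (by simpa using h)
        exact tr_ne_of_mem_D hk rfl
      rw [leftProd_nil]
      intro h1
      rw [leftProd_concat] at h1 htr'
      refine not_isGenPair_redFold_one (leftProd_ne_one_of_ne_nil 1 hβ) (fun z hz h2 => ?_)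
        (List.isChain_cons_cons.2 hs) hR h1.symm
      rw [h2, WithOne.coe_inj] at htr'
      exact tr_notMem_R_of_mem_D hk (htr' ▸ hz)
    · rw [List.concat_eq_append] at *
      have hα1 := leftProd_ne_one 1 α t
      have hWt : leftProd 1 (β ++ [b]) * (t : P X) ∈ W X := by
        rw [htr', List.reverse_append, List.reverse_singleton, ← List.append_assoc] at hW
        rw [← leftProd_concat]
        exact leftProd_mem_W_of_append hW
      have hβt := redMul_of_mul_mem_W hWt
      -- If `g` is the last factor of `α`, it passes from `α` to `β` and the splitting of `k`
      -- persists. Otherwise neither word cancels its last factor: each grows or, if equal to `g`,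
      -- vanishes.
      by_cases hgt : g = t
      · subst hgt
        rw [redFold_cons, redFold_cons, hβt, leftProd_concat, redMul_mul, ← leftProd_concat]
        exact ih (by rw [h]; simp) hs.2 hR'
      -- Multiplication by `t` shortens the first word but lengthens the second.
      · have hne : leftProd 1 (α ++ [t]) ≠ leftProd 1 (β ++ [b]) := by
          intro h1
          rw [← h1, leftProd_concat, redMul_mul] at hβt
          have h2 := congrArg len hβt
          have := t.length_pos
          simp only [len_mul_coe] at h2
          omega
        have hα := exists_of_cons_eq_of_factors h
        have hβ := exists_of_cons_eq_of_factors hf'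
        by_cases h1 : leftProd 1 (α ++ [t]) = g
        · have hg' := ne_of_of_leftProd_concat (Ne.symm hgt) h1
          have h2 : leftProd 1 (β ++ [b]) ≠ g := fun h => hne (h1.trans h.symm)
          rw [redFold_cons, redFold_cons, h1, redMul_self, redMul_leftProd_concat hβ hs.1 h2]
          exact fun h3 => not_isGenPair_redFold_one hβ1
            (fun z hz h => notMem_R_of_mul hβ1 hg' h hz) hs.2 hR' h3.symm
        · by_cases h2 : leftProd 1 (β ++ [b]) = g
          · have hg' := ne_of_of_leftProd_concat hs.1 h2
            rw [redFold_cons, redFold_cons, h2, redMul_self,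
              redMul_leftProd_concat hα (Ne.symm hgt) h1]
            exact not_isGenPair_redFold_one hα1
              (fun z hz h => notMem_R_of_mul hα1 hg' h hz) hs.2 hR'
          · rw [redFold_cons, redFold_cons, redMul_leftProd_concat hα (Ne.symm hgt) h1,
              redMul_leftProd_concat hβ hs.1 h2]
            exact not_isGenPair_redFold_mul_mul hα1 hβ1 hne hs.2 hR'

/-- A word `u` and the word `u k`, for a nonempty list that does not start with `k`. -/
theorem not_isGenPair_redFold_mul [LinearOrder X] {u : P X} (hu : u ∈ W X) {k : FreeMagma X}
    (hk : k ∈ R X) {s : List (FreeMagma X)} (hs0 : s ≠ []) (hs : (k :: s).IsChain (· ≠ ·))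
    (hR : ∀ a ∈ s, a ∈ R X) : ¬ IsGenPair (redFold (u * (k : P X)) s) (redFold u s) := by
  cases s with
  | nil => exact absurd rfl hs0
  | cons g s =>
    rw [List.isChain_cons_cons] at hs
    have hR' : ∀ a ∈ s, a ∈ R X := fun a ha => hR a (by simp [ha])
    -- Since `g ≠ k`, growth of `uk` fails only if `u` is empty and `k` ends in `g`, or if `uk`
    -- equals `g`.
    by_cases hg : redMul (u * (k : P X)) g = u * (k : P X) * (g : P X)
    · exact not_isGenPair_redFold_of_redMul hu hg hs.2 hR
    by_cases hu1 : u = 1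
    · subst hu1
      rw [one_mul] at *
      have h : ∃ c, (k : P X) = c * (g : P X) := by
        by_contra h
        exact hg (redMul_of_not h)
      obtain ⟨c, hc⟩ := h
      have hc1 : c ≠ 1 := by
        rintro rfl
        rw [one_mul, WithOne.coe_inj] at hc
        exact hs.1 hc
      obtain ⟨a, rfl, rfl⟩ := exists_mul_of_coe_eq hc1 hc.symm
      rw [redFold_cons, redFold_cons, one_redMul, WithOne.coe_mul, redMul_mul]
      have h1 := not_isGenPair_redFold_factors (mul_mem_D_of_mem_R hk) (α := factors a)
        (β := []) (b := g) rfl hs.2 hR'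
      rw [leftProd_factors, List.nil_append, leftProd_cons, one_mul, leftProd_nil] at h1
      exact h1
    · have h : u * (k : P X) = g := by
        by_contra h
        exact hg (redMul_mul_of_ne hu1 hs.1 h)
      have h1 : len u < g.length := by
        have h2 := congrArg len h
        have := k.length_pos
        rw [len_mul_coe, len_coe] at h2
        omega
      rw [redFold_cons, redFold_cons, h, redMul_self, redMul_of_len_lt h1]
      have hg' : ∀ x, g ≠ FreeMagma.of x := by
        rintro x rfl
        exact mul_coe_ne_of hu1 k x h
      exact fun h3 => not_isGenPair_redFold_one hu1
        (fun z hz h => notMem_R_of_mul hu1 hg' h hz) hs.2 hR' h3.symm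

/-! The symmetric representation of an element of `R(X)`. -/

/-- An element of `R(X)` has no other symmetric representation than the trivial one. -/
theorem IsSymRep.eq_singleton [LinearOrder X] {y : FreeMagma X} (hy : y ∈ R X)
    {l : List (FreeMagma X)} (h : IsSymRep (y : P X) l) : l = [y] := by
  obtain ⟨h0, hR, hc, he⟩ := h
  obtain ⟨w, k, rfl⟩ := (List.eq_nil_or_concat l).resolve_left h0
  rw [List.concat_eq_append] at *
  have hRw : ∀ a ∈ w, a ∈ R X := fun a ha => hR a (by simp [ha])
  have hRw' : ∀ a ∈ w, (a : P X) ∈ W X := fun a ha => R_subset_W (hRw a ha)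
  have hRr : ∀ a ∈ w.reverse, a ∈ R X := fun a ha => hRw a (List.mem_reverse.1 ha)
  have hk := hR k (by simp)
  rw [pi_leftProd _ 1 (one_mem_W X) fun a ha => R_subset_W (hR a (mem_of_mem_palin ha))] at he
  have hp : palin (w ++ [k]) = w ++ k :: w.reverse := by simp [palin]
  rw [hp, redFold_append, redFold_cons] at he
  have hu := redFold_mem_W (one_mem_W X) hRw'
  have h1 := redFold_redFold_reverse (one_mem_W X) hRw'
  by_cases hw : w = []
  · subst hw
    rw [List.reverse_nil, redFold_nil, redFold_nil, one_redMul, WithOne.coe_inj] at he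
    rw [List.nil_append, he]
  exfalso
  have hs0 : w.reverse ≠ [] := by simpa using hw
  have hs : (k :: w.reverse).IsChain (· ≠ ·) := by
    have h2 : (w ++ [k]).reverse = k :: w.reverse := by simp
    rw [← h2, List.isChain_reverse]
    exact hc.imp fun _ _ h => h.symm
  -- Whether `k` cancels or is appended, the two words are some `v` and `v * k`; only the order
  -- differs, and `IsGenPair` is symmetric.
  rcases redMul_cases k hu (R_subset_W hk) with ⟨c, hcW, h2, h3⟩ | ⟨-, h3⟩
  · rw [h3] at he
    rw [h2] at h1
    exact not_isGenPair_redFold_mul hcW hk hs0 hs hRr ⟨y, hy, Or.inl ⟨h1, he.symm⟩⟩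
  · rw [h3] at he
    exact not_isGenPair_redFold_mul hu hk hs0 hs hRr ⟨y, hy, Or.inr ⟨he.symm, h1⟩⟩

theorem circ_eq_redMul [LinearOrder X] {x : P X} {y : FreeMagma X} (hx : x ∈ B X)
    (hy : y ∈ R X) : circ x (y : P X) = redMul x y := by
  rw [circ_eq hx hy, (isSymRep_symList hy).eq_singleton hy]
  rfl

/-! The action of `G` on `B(X)` is faithful. -/

theorem coe_apply_prod_gen [LinearOrder X] (b : B X) (l : List (R X)) :
    (apply b (l.map gen).prod : P X) = redFold (b : P X) (l.map Subtype.val) := by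
  induction l generalizing b with
  | nil => rw [List.map_nil, List.prod_nil, apply_one]; rfl
  | cons y l ih =>
    rw [List.map_cons, List.prod_cons, apply_mul, ih, List.map_cons, redFold_cons, apply_gen,
      circ_eq_redMul b.2 y.2]

theorem eq_ofAdd_one {a : Multiplicative (ZMod 2)} (h : a ≠ 1) :
    a = Multiplicative.ofAdd (1 : ZMod 2) := by
  revert h
  revert a
  decide

/-- Every element of `G` is a product of generators, any two consecutive ones distinct. -/
theorem exists_eq_prod_gen [LinearOrder X] (g : G X) :
    ∃ l : List (R X), l.IsChain (· ≠ ·) ∧ g = (l.map gen).prod := by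
  classical
  let w := Monoid.CoprodI.Word.equiv g
  refine ⟨w.toList.map Sigma.fst, ?_, ?_⟩
  · rw [List.isChain_map]
    exact w.chain_ne
  · have h : w.prod = g := Monoid.CoprodI.Word.equiv.symm_apply_apply g
    rw [← h, Monoid.CoprodI.Word.prod, List.map_map]
    congr 1
    apply List.map_congr_left
    rintro ⟨y, a⟩ ha
    have h1 : a = Multiplicative.ofAdd (1 : ZMod 2) := eq_ofAdd_one (w.ne_one _ ha)
    subst h1
    rfl

/-! ### Long words in the orbit of the empty word. -/

theorem eq_of_of_mem_W_of_subsingleton [Subsingleton X] {a : FreeMagma X}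
    (ha : (a : P X) ∈ W X) : ∃ x, a = FreeMagma.of x := by
  induction a with
  | ih1 x => exact ⟨x, rfl⟩
  | ih2 a b iha ihb =>
    rw [mul_mem_W] at ha
    obtain ⟨x, rfl⟩ := iha ha.1
    obtain ⟨y, rfl⟩ := ihb ha.2.1
    exact absurd (congrArg _ (Subsingleton.elim x y)) ha.2.2.1

/-- Over at most one letter, every nonempty reduced word is a letter, so `R X` has at most one
element. -/
theorem nontrivial_of_mem_R [LinearOrder X] {y z : FreeMagma X} (hy : y ∈ R X) (hz : z ∈ R X)
    (h : y ≠ z) : Nontrivial X := by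
  by_contra hX
  rw [not_nontrivial_iff_subsingleton] at hX
  obtain ⟨x, rfl⟩ := eq_of_of_mem_W_of_subsingleton (R_subset_W hy)
  obtain ⟨x', rfl⟩ := eq_of_of_mem_W_of_subsingleton (R_subset_W hz)
  exact h (congrArg _ (Subsingleton.elim x x'))

/-- The orbit of the empty word contains arbitrarily long words. -/
theorem exists_apply_emptyWord [LinearOrder X] [Nontrivial X] (n : ℕ) :
    ∃ (a : G X) (c : P X) (x : X), c ≠ 1 ∧
      (apply (emptyWord X) a : P X) = c * ((FreeMagma.of x : FreeMagma X) : P X) ∧ n ≤ len c := by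
  induction n with
  | zero =>
    obtain ⟨x, x', h⟩ := exists_pair_ne X
    refine ⟨([⟨FreeMagma.of x, of_mem_R x⟩, ⟨FreeMagma.of x', of_mem_R x'⟩].map gen).prod,
      (FreeMagma.of x : FreeMagma X), x', WithOne.coe_ne_one, ?_, Nat.zero_le _⟩
    rw [coe_apply_prod_gen]
    simp only [List.map_cons, List.map_nil, redFold_cons, redFold_nil, emptyWord, one_redMul]
    refine redMul_of_mul_mem_W ?_
    rw [← WithOne.coe_mul, mul_mem_W]
    refine ⟨of_mem_W x, of_mem_W x', fun e => ?_, fun c e => ?_⟩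
    · injection e with e; exact h e
    · cases e
  | succ n ih =>
    obtain ⟨a, c, x, hc, h, hn⟩ := ih
    obtain ⟨x', hx⟩ := exists_ne x
    refine ⟨a * gen ⟨FreeMagma.of x', of_mem_R x'⟩, c * ((FreeMagma.of x : FreeMagma X) : P X),
      x', mul_coe_ne_one _ _, ?_, ?_⟩
    · rw [apply_mul, apply_gen, circ_eq_redMul (Subtype.prop _) (of_mem_R x'), h]
      refine redMul_mul_of_ne hc (fun e => ?_) (mul_coe_ne_of hc _ x')
      injection e with e; exact hx e.symm
    · rw [len_mul_coe]
      have := (FreeMagma.of x).length_pos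
      omega

theorem redFold_eq_leftProd_of_length_lt {c : P X} (hc : c ≠ 1) {b : FreeMagma X}
    {s : List (FreeMagma X)} (hs : (b :: s).IsChain (· ≠ ·))
    (h : ∀ a ∈ s, a.length < len (c * (b : P X))) :
    redFold (c * (b : P X)) s = leftProd (c * (b : P X)) s := by
  rcases redFold_eq_leftProd_or hc hs with h1 | ⟨s₁, z, s₂, rfl, h1, -⟩
  · exact h1
  · have h2 := h z (by simp)
    have h3 := length_le_of_leftProd_eq h1
    omega

/-- A nonempty list without equal neighbours moves some word in the orbit of the empty word. -/
theorem exists_apply_apply_ne [LinearOrder X] {l : List (R X)} (hl : l.IsChain (· ≠ ·))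
    (h0 : l ≠ []) :
    ∃ a : G X, apply (apply (emptyWord X) a) (l.map gen).prod ≠ apply (emptyWord X) a := by
  cases l with
  | nil => exact absurd rfl h0
  | cons y l =>
    cases l with
    | nil =>
      -- A single generator already moves the empty word. It is treated apart because `X` may have
      -- only one letter, and then no long words exist.
      refine ⟨1, fun h => ?_⟩
      have h1 := congrArg Subtype.val h
      rw [apply_one, coe_apply_prod_gen, List.map_cons, List.map_nil, redFold_cons, redFold_nil,
        emptyWord, one_redMul] at h1
      exact WithOne.coe_ne_one h1
    | cons z l =>
      have hX := nontrivial_of_mem_R y.2 z.2 fun e =>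
        (List.isChain_cons_cons.1 hl).1 (Subtype.ext e)
      have hl' : (((y :: z :: l).map Subtype.val) : List (FreeMagma X)).IsChain (· ≠ ·) := by
        rw [List.isChain_map]
        exact hl.imp fun _ _ h e => h (Subtype.ext e)
      -- The bound on `len c` makes the word longer than every factor of the list, so it never
      -- coincides with one of them.
      have key : ∀ (a : G X) (c : P X) (x : X), c ≠ 1 →
          (apply (emptyWord X) a : P X) = c * ((FreeMagma.of x : FreeMagma X) : P X) →
          (((y :: z :: l).map Subtype.val).map FreeMagma.length).sum ≤ len c →
          FreeMagma.of x ≠ (y : FreeMagma X) →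
          apply (apply (emptyWord X) a) ((y :: z :: l).map gen).prod ≠ apply (emptyWord X) a := by
        intro a c x hc h hn hx e
        have h1 := congrArg Subtype.val e
        have hs : (FreeMagma.of x :: (y :: z :: l).map Subtype.val).IsChain (· ≠ ·) :=
          List.isChain_cons_cons.2 ⟨hx, hl'⟩
        rw [coe_apply_prod_gen, h, redFold_eq_leftProd_of_length_lt hc hs] at h1
        · have h2 := congrArg len h1
          rw [len_leftProd] at h2
          have := (y : FreeMagma X).length_pos
          simp only [List.map_cons, List.sum_cons] at h2
          omega
        · intro b hb
          have h2 := List.le_sum_of_mem (List.mem_map_of_mem (f := FreeMagma.length) hb)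
          have := (FreeMagma.of x).length_pos
          rw [len_mul_coe]
          omega
      obtain ⟨a, c, x, hc, h, hn⟩ := exists_apply_emptyWord (X := X)
        (((y :: z :: l).map Subtype.val).map FreeMagma.length).sum
      -- If the last letter would cancel against `y`, one more, different letter is appended first.
      by_cases hx : FreeMagma.of x = (y : FreeMagma X)
      · obtain ⟨x', hx'⟩ := exists_ne x
        have hxx : FreeMagma.of x ≠ FreeMagma.of x' := fun e => by
          injection e with e
          exact hx' e.symm
        refine ⟨a * gen ⟨FreeMagma.of x', of_mem_R x'⟩, key _
          (c * ((FreeMagma.of x : FreeMagma X) : P X)) x' (mul_coe_ne_one _ _) ?_ ?_ ?_⟩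
        · rw [apply_mul, apply_gen, circ_eq_redMul (Subtype.prop _) (of_mem_R x'), h]
          exact redMul_mul_of_ne hc hxx (mul_coe_ne_of hc _ x')
        · rw [len_mul_coe]
          omega
        · rw [← hx]
          exact hxx.symm
      · exact ⟨a, key a c x hc h hn hx⟩

end FreeBol

theorem proposition5p1 {X : Type*} [LinearOrder X] [Finite X]
    (N : Subgroup (FreeBol.G X)) (hNH : N ≤ FreeBol.H X) (hN : N.Normal) : N = ⊥ := by
  rw [Subgroup.eq_bot_iff_forall]
  intro g hg
  obtain ⟨l, hl, rfl⟩ := FreeBol.exists_eq_prod_gen g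
  by_contra h1
  have h0 : l ≠ [] := by
    rintro rfl
    exact h1 rfl
  obtain ⟨a, ha⟩ := FreeBol.exists_apply_apply_ne hl h0
  -- By normality the conjugate also lies in `H`; for a right action this says that the element
  -- itself fixes the image of the empty word under `a`.
  have h2 : FreeBol.apply (FreeBol.emptyWord X) (a * (l.map FreeBol.gen).prod * a⁻¹) =
      FreeBol.emptyWord X := hNH (hN.conj_mem _ hg a)
  apply ha
  rw [← FreeBol.apply_mul]
  have h3 := congrArg (fun b => FreeBol.apply b a) h2
  simpa only [← FreeBol.apply_mul, inv_mul_cancel_right] using h3
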